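/- Let $d \ge 1$ be an integer, let $k, m > 0$ be real, let $\kappa \in (0,\infty]$, and let $\phi : (0,\kappa) \to \mathbb{R}$ be strictly increasing and convex with $\lim_{r \nearrow \kappa} \phi(r) = \infty$. Let $\pi$ be a probability distribution on $\mathbb{R}^d$ with (not necessarily normalized) Lebesgue density $\varrho$ given by $$\varrho(r\theta) = r^{k-d} \exp(-\phi(r^m))\, \mathbf{1}_{(0,\kappa)}(r^m), \qquad r \ge 0,\ \theta \in \mathbb{S}^{d-1}$$ (so $\varrho(0)=0$; the exponential is disregarded where the indicator vanishes). Let $P$ be the transition kernel of $k$-polar slice sampling for $\pi$. That is, with $\varrho_0(x) = \|x\|^{k-d}$ and $\varrho_1(x) = \|x\|^{d-k}\varrho(x)$ for $x \ne 0$, where $\|\cdot\|$ is the Euclidean norm, $P(x,\cdot)$ is, for $\varrho_1(x) > 0$, the distribution of the state produced by first drawing $t$ uniformly from $(0,\varrho_1(x))$ and then drawing the new state from $$\mu_t(A) = \frac{\int_A \varrho_0(y)\,\mathbf{1}\{\varrho_1(y) > t\}\,dy}{\int_{\mathbb{R}^d} \varrho_0(y)\,\mathbf{1}\{\varrho_1(y)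 > t\}\,dy}.$$ On the $\pi$-null set of all other states (including $x=0$) set, by convention, $P(x,\cdot) = \delta_x$. Then $P$ is a Markov kernel with invariant distribution $\pi$, and its spectral gap $\mathsf{gap}_\pi(P) := 1 - \|P - \pi\|_{L_2(\pi)\to L_2(\pi)}$ satisfies $$\mathsf{gap}_\pi(P) \ge \frac{m}{k+m}.$$ Here $Pg(x) = \int g(y)\,P(x,dy)$, and $\pi$ acts on $L_2(\pi)$ by $g \mapsto \int g\,d\pi$. -/

import Mathlib

open MeasureTheory ProbabilityTheory
open scoped ENNReal

noncomputable section

/-! ### Spectral gap of a Markov kernel -/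

section Gap

variable {G : Type*} [MeasurableSpace G]

/-- The action of a kernel on functions: `(P g)(x) = ∫ g(y) P(x, dy)`. -/
def kernelOp (P : Kernel G G) (g : G → ℝ) (x : G) : ℝ :=
  ∫ y, g y ∂(P x)

/-- The operator norm `‖P - ν‖` from `L₂(ν)` to `L₂(ν)`, where `ν` acts as the kernel that is
constant in its first argument: the supremum of `‖P g - ν(g)‖₂ / ‖g‖₂` over all `g ∈ L₂(ν)`.
It takes values in `[0, ∞]`, so that it is meaningful without any assumption on `P` and `ν`
(and `0 / 0 = 0` there, so that `g = 0` does not contribute). -/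
def l2OpNormSub (P : Kernel G G) (ν : Measure G) : ℝ≥0∞ :=
  ⨆ (g : G → ℝ) (_ : MemLp g 2 ν),
    eLpNorm (fun x => kernelOp P g x - ∫ y, g y ∂ν) 2 ν / eLpNorm g 2 ν

/-- The spectral gap `gap_ν(P) = 1 - ‖P - ν‖` of a kernel `P` with invariant distribution `ν`;
it would be `-∞` if `P - ν` were unbounded. -/
def spectralGap (P : Kernel G G) (ν : Measure G) : EReal :=
  1 - ((l2OpNormSub P ν : ℝ≥0∞) : EReal)

end Gap

/-! ### Slice sampling -/

section Slice

/-- Conditioning an s-finite measure on the sections of a measurable set is measurable. -/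
theorem measurable_cond_section {α β : Type*} [MeasurableSpace α] [MeasurableSpace β]
    (ν : Measure β) [SFinite ν] {S : Set (α × β)} (hS : MeasurableSet S) :
    Measurable (fun a => ProbabilityTheory.cond ν (Prod.mk a ⁻¹' S)) := by
  refine Measure.measurable_of_measurable_coe _ fun s hs => ?_
  have h : ∀ a, ProbabilityTheory.cond ν (Prod.mk a ⁻¹' S) s
      = (ν (Prod.mk a ⁻¹' S))⁻¹ * ν (Prod.mk a ⁻¹' (S ∩ (Set.univ ×ˢ s))) := by
    intro a
    rw [cond_apply (measurable_prodMk_left hS)]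
    congr 2
    ext b
    simp
  simp only [h]
  exact (measurable_measure_prodMk_left hS).inv.mul
    (measurable_measure_prodMk_left (hS.inter (MeasurableSet.univ.prod hs)))

variable {E : Type*} [MeasureSpace E] [SFinite (volume : Measure E)]

/-- The distribution `μ_t` of the `X`-update at threshold `t`: the measure with density `η₀`,
restricted to the slice `{y | η₁ y > t}` and normalized,
`μ_t(A) = ∫_A η₀(y) 1(η₁(y) > t) dy / ∫ η₀(y) 1(η₁(y) > t) dy`. -/
def xUpdate (η₀ η₁ : E → ℝ) (t : ℝ) : Measure E :=
  ProbabilityTheory.cond (volume.withDensity fun y => ENNReal.ofReal (η₀ y)) {y | t < η₁ y}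

/-- The uniform distribution on the interval `(0, a)`. -/
def unifIoo (a : ℝ) : Measure ℝ :=
  ProbabilityTheory.cond volume (Set.Ioo 0 a)

theorem measurable_xUpdate (η₀ : E → ℝ) {η₁ : E → ℝ} (h₁ : Measurable η₁) :
    Measurable (xUpdate η₀ η₁) :=
  measurable_cond_section (volume.withDensity fun y => ENNReal.ofReal (η₀ y))
    (S := {p : ℝ × E | p.1 < η₁ p.2})
    (measurableSet_lt measurable_fst (h₁.comp measurable_snd))

theorem measurable_unifIoo : Measurable unifIoo :=
  measurable_cond_section (volume : Measure ℝ)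
    (S := {p : ℝ × ℝ | 0 < p.2 ∧ p.2 < p.1})
    ((measurableSet_lt measurable_const measurable_snd).inter
      (measurableSet_lt measurable_snd measurable_fst))

open Classical in
/-- The transition kernel of slice sampling for the density `η = η₀ η₁`: from the state `x`, draw
a threshold `t` uniformly from `(0, η₁ x)`, then draw the new state from `μ_t`. At the states with
`η₁ x ≤ 0`, where `(0, η₁ x)` is empty and which the target distribution does not charge, the
chain stays put. -/
def sliceKernel (η₀ η₁ : E → ℝ) (h₁ : Measurable η₁) : Kernel E E where
  toFun x := if 0 < η₁ x then (unifIoo (η₁ x)).bind (xUpdate η₀ η₁) else Measure.dirac x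
  measurable' := Measurable.ite (measurableSet_lt measurable_const h₁)
    ((Measure.measurable_bind' (measurable_xUpdate η₀ h₁)).comp (measurable_unifIoo.comp h₁))
    Measure.measurable_dirac

end Slice

/-! ### `k`-polar slice sampling on `ℝ^d` -/

section KPSS

variable {d : ℕ}

/-- The first factor `‖x‖^(k-d)` of `k`-polar slice sampling. -/
def kpssFactor₀ (d : ℕ) (k : ℝ) (x : EuclideanSpace ℝ (Fin d)) : ℝ :=
  ‖x‖ ^ (k - d)

/-- The second factor `‖x‖^(d-k) η(x)` of `k`-polar slice sampling. -/
def kpssFactor₁ (k : ℝ) (η : EuclideanSpace ℝ (Fin d) → ℝ) (x : EuclideanSpace ℝ (Fin d)) : ℝ :=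
  ‖x‖ ^ ((d : ℝ) - k) * η x

theorem measurable_kpssFactor₁ (k : ℝ) {η : EuclideanSpace ℝ (Fin d) → ℝ} (h : Measurable η) :
    Measurable (kpssFactor₁ k η) :=
  (measurable_norm.pow_const _).mul h

/-- The transition kernel of `k`-polar slice sampling for the density `η`. -/
def kpssKernel (k : ℝ) (η : EuclideanSpace ℝ (Fin d) → ℝ) (h : Measurable η) :
    Kernel (EuclideanSpace ℝ (Fin d)) (EuclideanSpace ℝ (Fin d)) :=
  sliceKernel (kpssFactor₀ d k) (kpssFactor₁ k η) (measurable_kpssFactor₁ k h)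

/-- `η` is a (not necessarily normalized) density of `ν` with respect to Lebesgue measure. -/
structure HasUnnormalizedDensity (ν : Measure (EuclideanSpace ℝ (Fin d)))
    (η : EuclideanSpace ℝ (Fin d) → ℝ) : Prop where
  measurable : Measurable η
  nonneg : ∀ x, 0 ≤ η x
  exists_const : ∃ c : ℝ, 0 < c ∧ ν = volume.withDensity fun x => ENNReal.ofReal (c * η x)

/-- The interval `(0, κ)` of real numbers, for an endpoint `κ` that may be `∞`. -/
def openInterval (κ : EReal) : Set ℝ :=
  {r | 0 < r ∧ (r : EReal) < κ}

end KPSS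

end

/-! Let V(x) = ‖x‖^m. From x with V(x) = v, the threshold is t = u·exp(-φ(v)) with u uniform on
(0,1), and its slice is the punctured ball V < q, where φ(q) = φ(v) - log u. In polar coordinates
the weight ‖y‖^(k-d) cancels the dimension: on this slice V is distributed as q·Z^m, where Z has
density k z^(k-1) on (0,1), and E[Z^m] = k/(k+m). By convexity q is a nonexpansive function of v for
fixed u (`abs_sub_le_of_convexOn`). Using the same u and Z from two starting points shows that P
contracts the Lipschitz constant of functions of V by k/(k+m) (`abs_kernelOp_kpssKernel_sub_le`).

Reversibility turns this into an L² bound. The iterates of the self-adjoint operator P - π on a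
Lipschitz function of V decay at rate k/(k+m), which forces contraction by that factor on the
function itself (`norm_apply_le_of_iterate_decay`). As P(x,·) depends on x only through V(x), the
range of P - π consists of functions of V, which are L²-limits of Lipschitz functions of V. Hence ‖P
- π‖ ≤ k/(k+m) (`norm_centeredKernelL2_le`). -/

/-! ### Symmetric operators: from decay of iterates to a norm bound. -/

section Hilbert

variable {H : Type*} [NormedAddCommGroup H] [InnerProductSpace ℝ H]

/-- A symmetric operator whose iterates at `f` decay at rate `c` contracts `f` by the factor `c`. -/
theorem norm_apply_le_of_iterate_decay (T : H →L[ℝ] H)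
    (hT : ∀ f g : H, inner ℝ (T f) g = inner ℝ f (T g)) {c C : ℝ} (hc : 0 < c) (f : H)
    (hf : ∀ n : ℕ, ‖(T ^ n) f‖ ≤ C * c ^ n) : ‖T f‖ ≤ c * ‖f‖ := by
  by_contra! hlt
  have hf0 : 0 < ‖f‖ := by
    rcases eq_or_ne f 0 with rfl | h
    · simp at hlt
    · exact norm_pos_iff.2 h
  set r := ‖T f‖ / ‖f‖ with hr
  have hrc : c < r := (lt_div_iff₀ hf0).2 hlt
  have hr0 : 0 < r := hc.trans hrc
  have hsucc : ∀ n, (T ^ (n + 1)) f = T ((T ^ n) f) := fun n => by rw [pow_succ']; rfl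
  -- Symmetry and Cauchy–Schwarz make n ↦ ‖T^n f‖ log-convex, so successive ratios never fall below
  -- the first ratio r.
  have hlog : ∀ n, ‖(T ^ (n + 1)) f‖ ^ 2 ≤ ‖(T ^ n) f‖ * ‖(T ^ (n + 2)) f‖ := fun n => by
    rw [← real_inner_self_eq_norm_sq]
    conv_lhs => rw [hsucc n, hT, ← hsucc n, ← hsucc (n + 1)]
    exact real_inner_le_norm _ _
  have key : ∀ n, 0 < ‖(T ^ n) f‖ ∧ r * ‖(T ^ n) f‖ ≤ ‖(T ^ (n + 1)) f‖ := by
    intro n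
    induction n with
    | zero => simpa [hf0, hr] using (div_mul_cancel₀ ‖T f‖ hf0.ne').le
    | succ n ih =>
      have h1 : 0 < ‖(T ^ (n + 1)) f‖ := (mul_pos hr0 ih.1).trans_le ih.2
      refine ⟨h1, le_of_mul_le_mul_left ?_ ih.1⟩
      nlinarith [hlog n, ih.2]
  have hpow : ∀ n, r ^ n * ‖f‖ ≤ ‖(T ^ n) f‖ := by
    intro n
    induction n with
    | zero => simp
    | succ n ih => rw [pow_succ']; nlinarith [(key n).2]
  -- Growth at least r^n with r > c contradicts the bound C·c^n for large n.
  obtain ⟨n, hn⟩ := pow_unbounded_of_one_lt (C / ‖f‖) ((one_lt_div hc).2 hrc)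
  rw [div_lt_iff₀ hf0, div_pow, div_mul_eq_mul_div, lt_div_iff₀ (pow_pos hc n)] at hn
  linarith [hpow n, hf n]

/-- A symmetric operator with range in the closure of a set of vectors on which its iterates decay
at rate `c` has norm at most `c`. -/
theorem norm_apply_le_of_dense_decay (T : H →L[ℝ] H)
    (hT : ∀ f g : H, inner ℝ (T f) g = inner ℝ f (T g)) {c : ℝ} (hc : 0 < c) {D : Set H}
    (hD : ∀ f ∈ D, ∃ C, ∀ n : ℕ, ‖(T ^ n) f‖ ≤ C * c ^ n) (hr : ∀ f, T f ∈ closure D) (f : H) :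
    ‖T f‖ ≤ c * ‖f‖ := by
  have hcl : ∀ u ∈ closure D, ‖T u‖ ≤ c * ‖u‖ := by
    have hclosed : IsClosed {u : H | ‖T u‖ ≤ c * ‖u‖} :=
      isClosed_le (by fun_prop) (by fun_prop)
    refine fun u hu => closure_minimal (fun f hf => ?_) hclosed hu
    obtain ⟨C, hC⟩ := hD f hf
    exact norm_apply_le_of_iterate_decay T hT hc f hC
  rcases eq_or_ne (T f) 0 with h0 | h0
  · rw [h0, norm_zero]; positivity
  -- The bound is known only on the closure of D, so it is applied to T f and moved to f through ‖T
  -- f‖² = ⟨f, T(T f)⟩.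
  · refine le_of_mul_le_mul_right ?_ (norm_pos_iff.2 h0)
    calc ‖T f‖ * ‖T f‖ = inner ℝ f (T (T f)) := by rw [← hT, real_inner_self_eq_norm_mul_norm]
      _ ≤ ‖f‖ * ‖T (T f)‖ := real_inner_le_norm _ _
      _ ≤ ‖f‖ * (c * ‖T f‖) := by gcongr; exact hcl _ (hr f)
      _ = c * ‖f‖ * ‖T f‖ := by ring

end Hilbert

/-! ### Markov kernels as operators on L² of an invariant law. -/

section KernelL2

variable {G : Type*} [MeasurableSpace G] {P : Kernel G G} {ν : Measure G}

/-- By invariance a ν-null set is P(x,·)-null for almost every x, so P acts on almost-everywhere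
classes. -/
theorem kernelOp_congr (h : Kernel.Invariant P ν) {f g : G → ℝ} (hfg : f =ᵐ[ν] g) :
    kernelOp P f =ᵐ[ν] kernelOp P g := by
  have : ∀ᵐ x ∂ν, ∀ᵐ y ∂(P x), f y = g y := by
    apply Measure.ae_ae_of_ae_comp
    rw [h.def]; exact hfg
  filter_upwards [this] with x hx
  exact integral_congr_ae hx

theorem ae_integrable_kernel (h : Kernel.Invariant P ν) {f : G → ℝ} (hf : Integrable f ν) :
    ∀ᵐ x ∂ν, Integrable f (P x) := by
  apply Measure.ae_integrable_of_integrable_comp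
  rw [h.def]; exact hf

theorem aestronglyMeasurable_kernelOp (h : Kernel.Invariant P ν) {f : G → ℝ}
    (hf : AEStronglyMeasurable f ν) : AEStronglyMeasurable (kernelOp P f) ν := by
  refine AEStronglyMeasurable.congr ?_ (kernelOp_congr h hf.ae_eq_mk.symm)
  exact (hf.stronglyMeasurable_mk.integral_kernel (κ := P)).aestronglyMeasurable

variable [IsMarkovKernel P]

/-- Jensen's inequality under each probability P(x,·), then integration using νP = ν. -/
theorem eLpNorm_kernelOp_le (h : Kernel.Invariant P ν) {f : G → ℝ}
    (hf : AEStronglyMeasurable f ν) : eLpNorm (kernelOp P f) 2 ν ≤ eLpNorm f 2 ν := by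
  rw [eLpNorm_congr_ae (kernelOp_congr h hf.ae_eq_mk), eLpNorm_congr_ae hf.ae_eq_mk]
  set g := hf.mk f
  have hg : StronglyMeasurable g := hf.stronglyMeasurable_mk
  have key : ∀ x, ‖kernelOp P g x‖ₑ ^ (2 : ℝ) ≤ ∫⁻ y, ‖g y‖ₑ ^ (2 : ℝ) ∂(P x) := by
    intro x
    have h1 : ‖kernelOp P g x‖ₑ ≤ eLpNorm g 1 (P x) := by
      rw [eLpNorm_one_eq_lintegral_enorm]; exact enorm_integral_le_lintegral_enorm _
    have h2 := h1.trans (eLpNorm_le_eLpNorm_of_exponent_le (p := 1) (q := 2) (by norm_num)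
      hg.aestronglyMeasurable)
    rw [eLpNorm_eq_lintegral_rpow_enorm_toReal (by norm_num) (by norm_num)] at h2
    have h3 := ENNReal.rpow_le_rpow h2 (z := 2) (by norm_num)
    rw [← ENNReal.rpow_mul] at h3
    simpa using h3
  rw [eLpNorm_eq_lintegral_rpow_enorm_toReal (by norm_num) (by norm_num),
    eLpNorm_eq_lintegral_rpow_enorm_toReal (by norm_num) (by norm_num)]
  refine ENNReal.rpow_le_rpow ?_ (by norm_num)
  simp only [ENNReal.toReal_ofNat]
  refine (lintegral_mono key).trans_eq ?_
  conv_rhs => rw [← h.def]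
  rw [Measure.lintegral_bind P.aemeasurable (by fun_prop)]

theorem memLp_kernelOp (h : Kernel.Invariant P ν) {f : G → ℝ} (hf : MemLp f 2 ν) :
    MemLp (kernelOp P f) 2 ν :=
  ⟨aestronglyMeasurable_kernelOp h hf.1, (eLpNorm_kernelOp_le h hf.1).trans_lt hf.2⟩

variable [IsProbabilityMeasure ν]

/-- Both sides integrate a product over ν ⊗ P, which reversibility makes invariant under swapping
coordinates. -/
theorem integral_mul_kernelOp_comm (h : Kernel.IsReversible P ν) {f g : G → ℝ}
    (hf : MemLp f 2 ν) (hg : MemLp g 2 ν) :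
    ∫ x, f x * kernelOp P g x ∂ν = ∫ x, g x * kernelOp P f x ∂ν := by
  have hswap : (ν ⊗ₘ P).map Prod.swap = ν ⊗ₘ P := by
    refine Measure.ext_prod fun {s t} hs ht => ?_
    rw [Measure.map_apply measurable_swap (hs.prod ht), Set.preimage_swap_prod,
      Measure.compProd_apply_prod ht hs, Measure.compProd_apply_prod hs ht, h ht hs]
  have hfst : Measure.map Prod.fst (ν ⊗ₘ P) = ν := Measure.fst_compProd ν P
  have hsnd : Measure.map Prod.snd (ν ⊗ₘ P) = ν := by
    conv_rhs => rw [← h.invariant.def]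
    exact Measure.snd_compProd ν P
  have hpres : MeasurePreserving Prod.swap (ν ⊗ₘ P) (ν ⊗ₘ P) := ⟨measurable_swap, hswap⟩
  have hint : ∀ {f g : G → ℝ}, MemLp f 2 ν → MemLp g 2 ν →
      Integrable (fun p : G × G => f p.1 * g p.2) (ν ⊗ₘ P) := by
    intro f g hf hg
    exact MemLp.integrable_mul
      (MemLp.comp_measurePreserving hf ⟨measurable_fst, hfst⟩)
      (MemLp.comp_measurePreserving hg ⟨measurable_snd, hsnd⟩)
  have hform : ∀ {f g : G → ℝ}, MemLp f 2 ν → MemLp g 2 ν →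
      ∫ x, f x * kernelOp P g x ∂ν = ∫ p, f p.1 * g p.2 ∂(ν ⊗ₘ P) := by
    intro f g hf hg
    rw [Measure.integral_compProd (hint hf hg)]
    simp only [integral_const_mul]
    rfl
  rw [hform hf hg, hform hg hf]
  conv_lhs => rw [← hswap]
  rw [integral_map measurable_swap.aemeasurable
    (by rw [hswap]; exact (hint hf hg).aestronglyMeasurable)]
  simp [mul_comm]

/-- A Markov kernel as an operator on `L²` of an invariant distribution. -/
noncomputable def kernelL2 (h : Kernel.Invariant P ν) : Lp ℝ 2 ν →L[ℝ] Lp ℝ 2 ν :=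
  LinearMap.mkContinuous
    { toFun := fun f => (memLp_kernelOp h (Lp.memLp f)).toLp
      map_add' := fun f g => by
        rw [← MemLp.toLp_add, MemLp.toLp_eq_toLp_iff]
        have hI : ∀ f : Lp ℝ 2 ν, ∀ᵐ x ∂ν, Integrable f (P x) := fun f =>
          ae_integrable_kernel h ((Lp.memLp f).integrable (by norm_num))
        filter_upwards [kernelOp_congr h (Lp.coeFn_add f g), hI f, hI g] with x hx hf hg
        rw [hx]
        exact integral_add hf hg
      map_smul' := fun r f => by
        rw [← MemLp.toLp_const_smul, MemLp.toLp_eq_toLp_iff]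
        filter_upwards [kernelOp_congr h (Lp.coeFn_smul r f)] with x hx
        rw [hx]
        exact integral_const_mul _ _ }
    1 fun f => by
      rw [one_mul]
      refine ENNReal.toReal_le_of_le_ofReal (norm_nonneg _) ?_
      rw [ENNReal.ofReal_eq_coe_nnreal (norm_nonneg _)]
      change eLpNorm ((memLp_kernelOp h (Lp.memLp f)).toLp : G → ℝ) 2 ν ≤ ‖f‖ₑ
      rw [eLpNorm_congr_ae (MemLp.coeFn_toLp _), Lp.enorm_def]
      exact eLpNorm_kernelOp_le h (Lp.aestronglyMeasurable f)

theorem coeFn_kernelL2 (h : Kernel.Invariant P ν) (f : Lp ℝ 2 ν) :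
    kernelL2 h f =ᵐ[ν] kernelOp P f := MemLp.coeFn_toLp (memLp_kernelOp h (Lp.memLp f))

/-- The operator `P - ν` on `L²(ν)`. -/
noncomputable def centeredKernelL2 (h : Kernel.Invariant P ν) : Lp ℝ 2 ν →L[ℝ] Lp ℝ 2 ν :=
  kernelL2 h - (innerSL ℝ (Lp.const 2 ν (1 : ℝ))).smulRight (Lp.const 2 ν (1 : ℝ))

theorem inner_const_one (f : Lp ℝ 2 ν) :
    inner ℝ (Lp.const 2 ν (1 : ℝ)) f = ∫ x, f x ∂ν := by
  rw [L2.inner_def]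
  refine integral_congr_ae ?_
  filter_upwards [Lp.coeFn_const (p := 2) (μ := ν) (1 : ℝ)] with x hx
  rw [hx]
  simp

theorem coeFn_centeredKernelL2 (h : Kernel.Invariant P ν) (f : Lp ℝ 2 ν) :
    centeredKernelL2 h f =ᵐ[ν] fun x => kernelOp P f x - ∫ y, f y ∂ν := by
  rw [centeredKernelL2]
  simp only [_root_.sub_apply, ContinuousLinearMap.smulRight_apply,
    innerSL_apply_apply, inner_const_one]
  filter_upwards [Lp.coeFn_sub (kernelL2 h f) ((∫ y, f y ∂ν) • Lp.const 2 ν (1 : ℝ)),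
    coeFn_kernelL2 h f, Lp.coeFn_smul (∫ y, f y ∂ν) (Lp.const 2 ν (1 : ℝ)),
    Lp.coeFn_const (p := 2) (μ := ν) (1 : ℝ)] with x h1 h2 h3 h4
  rw [h1, Pi.sub_apply, h2, h3, Pi.smul_apply, h4]
  simp

theorem inner_centeredKernelL2_comm (h : Kernel.IsReversible P ν) (f g : Lp ℝ 2 ν) :
    inner ℝ (centeredKernelL2 h.invariant f) g = inner ℝ f (centeredKernelL2 h.invariant g) := by
  have hP : inner ℝ (kernelL2 h.invariant f) g = inner ℝ f (kernelL2 h.invariant g) := by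
    rw [L2.inner_def, L2.inner_def]
    have := integral_mul_kernelOp_comm h (Lp.memLp f) (Lp.memLp g)
    calc _ = ∫ x, g x * kernelOp P f x ∂ν := integral_congr_ae (by
            filter_upwards [coeFn_kernelL2 h.invariant f] with x hx; simp [hx])
      _ = ∫ x, f x * kernelOp P g x ∂ν := this.symm
      _ = _ := integral_congr_ae (by
            filter_upwards [coeFn_kernelL2 h.invariant g] with x hx; simp [hx, mul_comm])
  simp only [centeredKernelL2, _root_.sub_apply, inner_sub_left, inner_sub_right, hP,
    ContinuousLinearMap.smulRight_apply, innerSL_apply_apply, inner_smul_left, inner_smul_right]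
  simp only [RCLike.conj_to_real, real_inner_comm]
  ring

theorem l2OpNormSub_le (h : Kernel.Invariant P ν) {c : ℝ} (hc : 0 ≤ c)
    (hb : ∀ f, ‖centeredKernelL2 h f‖ ≤ c * ‖f‖) : l2OpNormSub P ν ≤ ENNReal.ofReal c := by
  refine iSup₂_le fun g hg => ENNReal.div_le_of_le_mul ?_
  have h1 := hb (hg.toLp g)
  have hmean : ∫ y, (hg.toLp g) y ∂ν = ∫ y, g y ∂ν := integral_congr_ae hg.coeFn_toLp
  have heq : (fun x => kernelOp P g x - ∫ y, g y ∂ν) =ᵐ[ν] centeredKernelL2 h (hg.toLp g) := by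
    filter_upwards [coeFn_centeredKernelL2 h (hg.toLp g), kernelOp_congr h hg.coeFn_toLp]
      with x h2 h3
    rw [h2, h3, hmean]
  rw [eLpNorm_congr_ae heq, ← eLpNorm_congr_ae hg.coeFn_toLp, ← Lp.enorm_def, ← Lp.enorm_def,
    ← ofReal_norm, ← ofReal_norm, ← ENNReal.ofReal_mul hc]
  exact ENNReal.ofReal_le_ofReal h1

end KernelL2

/-! ### From Lipschitz contraction to L² contraction. -/

section LipschitzObservable

variable {G : Type*} [MeasurableSpace G] {P : Kernel G G} {ν : Measure G} [IsMarkovKernel P]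
  [IsProbabilityMeasure ν]

theorem integral_kernelOp (h : Kernel.IsReversible P ν) {f : G → ℝ} (hf : MemLp f 2 ν) :
    ∫ x, kernelOp P f x ∂ν = ∫ x, f x ∂ν := by
  have := integral_mul_kernelOp_comm h (memLp_const (1 : ℝ)) hf
  simpa [kernelOp] using this

/-- Elements of `L²` that are Lipschitz functions of `V`. -/
def lipschitzOf (ν : Measure G) (V : G → ℝ) (K : NNReal) : Set (Lp ℝ 2 ν) :=
  {f | ∃ F : ℝ → ℝ, LipschitzWith K F ∧ f =ᵐ[ν] F ∘ V}

/-- Mean zero controls F(0) by K·∫‖V‖, so the L² norm is at most linear in K and decays whenever the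
Lipschitz constants do. -/
theorem norm_le_of_mem_lipschitzOf {V : G → ℝ} (hV : MemLp V 2 ν) {K : NNReal} {f : Lp ℝ 2 ν}
    (hf : f ∈ lipschitzOf ν V K) (h0 : ∫ x, f x ∂ν = 0) :
    ‖f‖ ≤ K * ‖(hV.norm.add (memLp_const (∫ x, ‖V x‖ ∂ν))).toLp‖ := by
  obtain ⟨F, hF, hfF⟩ := hf
  have hVi : Integrable V ν := hV.integrable (by norm_num)
  have hLip : ∀ v, ‖F v - F 0‖ ≤ K * ‖v‖ := fun v => by
    simpa using hF.norm_sub_le v 0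
  have hFi : Integrable (F ∘ V) ν := ((Lp.memLp f).integrable (by norm_num)).congr hfF
  have hF0 : ‖F 0‖ ≤ K * ∫ x, ‖V x‖ ∂ν := by
    have h1 : ∫ x, (F (V x) - F 0) ∂ν = - F 0 := by
      have : ∫ x, F (V x) ∂ν = 0 := by rw [← h0]; exact integral_congr_ae hfF.symm
      rw [integral_sub (f := fun x => F (V x)) hFi (integrable_const _), this]; simp
    rw [← norm_neg, ← h1, ← integral_const_mul]
    exact norm_integral_le_of_norm_le (hVi.norm.const_mul _) (ae_of_all _ fun x => hLip _)
  apply Lp.norm_le_mul_norm_of_ae_le_mul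
  filter_upwards [hfF, (hV.norm.add (memLp_const (∫ x, ‖V x‖ ∂ν))).coeFn_toLp] with x h1 h2
  rw [h1, h2]
  have h3 : 0 ≤ ∫ x, ‖V x‖ ∂ν := integral_nonneg fun x => norm_nonneg _
  simp only [Function.comp_apply, Pi.add_apply]
  rw [Real.norm_of_nonneg (add_nonneg (norm_nonneg (V x)) h3), mul_add]
  calc ‖F (V x)‖ = ‖(F (V x) - F 0) + F 0‖ := by simp
    _ ≤ _ := (norm_add_le _ _).trans (add_le_add (hLip _) hF0)

/-- A reversible kernel that contracts the Lipschitz seminorm with respect to an observable `V`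
by the factor `c`, and that maps every function to a function of `V`, contracts the mean-zero
functions in `L²` by the factor `c`. -/
theorem norm_centeredKernelL2_le (h : Kernel.IsReversible P ν) {V : G → ℝ} (hVm : Measurable V)
    (hV : MemLp V 2 ν) {c : NNReal} (hc : 0 < c)
    (hLip : ∀ K F, LipschitzWith K F →
      ∃ F', LipschitzWith (c * K) F' ∧ kernelOp P (F ∘ V) =ᵐ[ν] F' ∘ V)
    (hfac : ∀ f, MemLp f 2 ν → ∃ U : ℝ → ℝ, Measurable U ∧ kernelOp P f =ᵐ[ν] U ∘ V)
    (f : Lp ℝ 2 ν) : ‖centeredKernelL2 h.invariant f‖ ≤ c * ‖f‖ := by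
  have hstep : ∀ K, ∀ f ∈ lipschitzOf ν V K,
      centeredKernelL2 h.invariant f ∈ lipschitzOf ν V (c * K) := by
    rintro K f ⟨F, hF, hfF⟩
    obtain ⟨F', hF', hPF⟩ := hLip K F hF
    refine ⟨fun v => F' v - ∫ y, f y ∂ν, ?_, ?_⟩
    · exact LipschitzWith.of_dist_le_mul fun x y => by simpa using hF'.dist_le_mul x y
    · filter_upwards [coeFn_centeredKernelL2 h.invariant f, kernelOp_congr h.invariant hfF, hPF]
        with x h1 h2 h3
      rw [h1, h2, h3]; rfl
  have hmean : ∀ f, ∫ x, centeredKernelL2 h.invariant f x ∂ν = 0 := by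
    intro f
    rw [integral_congr_ae (coeFn_centeredKernelL2 h.invariant f), integral_sub
      ((memLp_kernelOp h.invariant (Lp.memLp f)).integrable (by norm_num)) (integrable_const _),
      integral_kernelOp h (Lp.memLp f)]
    simp
  refine norm_apply_le_of_dense_decay _ (inner_centeredKernelL2_comm h) (NNReal.coe_pos.2 hc)
    (D := {f | ∃ K, f ∈ lipschitzOf ν V K}) ?_ ?_ f
  · rintro f ⟨K, hf⟩
    set B := ‖(hV.norm.add (memLp_const (∫ x, ‖V x‖ ∂ν))).toLp‖
    -- The summand ‖f‖ serves n = 0, where f need not have mean zero; later iterates do.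
    refine ⟨‖f‖ + K * B, fun n => ?_⟩
    have hmem : ∀ n : ℕ, (centeredKernelL2 h.invariant ^ n) f ∈ lipschitzOf ν V (c ^ n * K) := by
      intro n
      induction n with
      | zero => simpa using hf
      | succ n ih =>
        have := hstep _ _ ih
        rw [pow_succ' c, mul_assoc, pow_succ']
        exact this
    rcases n with _ | n
    · have : 0 ≤ (K : ℝ) * B := by positivity
      simpa using this
    · have h1 := norm_le_of_mem_lipschitzOf hV (hmem (n + 1)) (by
        rw [pow_succ']; exact hmean _)
      rw [NNReal.coe_mul, NNReal.coe_pow] at h1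
      have h2 : 0 ≤ ‖f‖ * (c : ℝ) ^ (n + 1) := by positivity
      change _ ≤ _ * B at h1
      linarith
  -- T f factors through V; smooth compactly supported functions are dense in L² of the law of V,
  -- and they are Lipschitz.
  · intro f
    obtain ⟨U, hUm, hU⟩ := hfac f (Lp.memLp f)
    set T := centeredKernelL2 h.invariant f
    set U' : ℝ → ℝ := fun v => U v - ∫ y, f y ∂ν
    have hU'm : Measurable U' := hUm.sub_const _
    have hTU : T =ᵐ[ν] U' ∘ V := by
      filter_upwards [coeFn_centeredKernelL2 h.invariant f, hU] with x h1 h2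
      rw [h1, h2]; rfl
    have hU'L : MemLp U' 2 (ν.map V) := by
      rw [memLp_map_measure_iff hU'm.aestronglyMeasurable hVm.aemeasurable]
      exact (memLp_congr_ae hTU).1 (Lp.memLp T)
    have := Measure.isProbabilityMeasure_map (μ := ν) hVm.aemeasurable
    rw [Metric.mem_closure_iff]
    intro ε hε
    obtain ⟨g, hg1, hg2, hg3⟩ := hU'L.exist_eLpNorm_sub_le (by norm_num) (by norm_num)
      (half_pos hε)
    obtain ⟨K, hK⟩ := hg2.lipschitzWith_of_hasCompactSupport hg1 (by simp)
    have hgL : MemLp (g ∘ V) 2 ν := by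
      rw [← memLp_map_measure_iff hg2.continuous.aestronglyMeasurable hVm.aemeasurable]
      exact hg2.continuous.memLp_of_hasCompactSupport hg1
    refine ⟨hgL.toLp, ⟨K, g, hK, hgL.coeFn_toLp⟩, ?_⟩
    have hd : edist T hgL.toLp ≤ ENNReal.ofReal (ε / 2) := by
      rw [Lp.edist_def, eLpNorm_congr_ae (hTU.sub hgL.coeFn_toLp)]
      rw [eLpNorm_map_measure (hU'm.sub hg2.continuous.measurable).aestronglyMeasurable
        hVm.aemeasurable] at hg3
      exact hg3
    rw [edist_dist, ENNReal.ofReal_le_ofReal_iff (half_pos hε).le] at hd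
    linarith

end LipschitzObservable

/-! ### Slice sampling in general: reversibility and threshold integrals. -/

section SliceKernel

variable {E : Type*} [MeasureSpace E] [SFinite (volume : Measure E)] {η₀ η₁ : E → ℝ}

theorem sliceKernel_of_pos (h₁ : Measurable η₁) {x : E} (hx : 0 < η₁ x) :
    sliceKernel η₀ η₁ h₁ x = (unifIoo (η₁ x)).bind (xUpdate η₀ η₁) := if_pos hx

theorem unifIoo_eq (a : ℝ) :
    unifIoo a = (ENNReal.ofReal a)⁻¹ • volume.restrict (Set.Ioo 0 a) := by
  simp [unifIoo, ProbabilityTheory.cond]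

/-- Rescaling to u in (0,1) lets two starting points share the same u. -/
theorem integral_unifIoo {a : ℝ} (ha : 0 < a) (f : ℝ → ℝ) :
    ∫ t, f t ∂(unifIoo a) = ∫ u in (0 : ℝ)..1, f (a * u) := by
  rw [unifIoo_eq, integral_smul_measure, intervalIntegral.integral_comp_mul_left f ha.ne',
    mul_zero, mul_one, intervalIntegral.integral_of_le ha.le, integral_Ioc_eq_integral_Ioo]
  simp [ha.le]

theorem intervalIntegrable_of_integrable_unifIoo {a : ℝ} (ha : 0 < a) {f : ℝ → ℝ}
    (hf : Integrable f (unifIoo a)) : IntervalIntegrable (fun u => f (a * u)) volume 0 1 := by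
  rw [unifIoo_eq, integrable_smul_measure (by simp) (by simpa using ha)] at hf
  have : IntervalIntegrable f volume 0 a := by
    rw [intervalIntegrable_iff_integrableOn_Ioo_of_le ha.le]; exact hf
  simpa [ha.ne'] using this.comp_mul_left (c := a)

/-- The factor η₁(x) cancels the normalization of the uniform law; where η₁(x) ≤ 0 both sides
vanish. -/
theorem ofReal_mul_sliceKernel_apply (h₁ : Measurable η₁) (x : E) {B : Set E}
    (hB : MeasurableSet B) :
    ENNReal.ofReal (η₁ x) * sliceKernel η₀ η₁ h₁ x B
      = ∫⁻ t in Set.Ioi 0, {p : ℝ × E | p.1 < η₁ p.2}.indicator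
          (fun p => xUpdate η₀ η₁ p.1 B) (t, x) := by
  by_cases hx : 0 < η₁ x
  · rw [sliceKernel_of_pos h₁ hx, Measure.bind_apply hB (measurable_xUpdate η₀ h₁).aemeasurable,
      unifIoo_eq, lintegral_smul_measure, smul_eq_mul, ← mul_assoc,
      ENNReal.mul_inv_cancel (by simpa using hx) (by simp), one_mul]
    have : ∀ t, {p : ℝ × E | p.1 < η₁ p.2}.indicator (fun p => xUpdate η₀ η₁ p.1 B) (t, x)
        = (Set.Iio (η₁ x)).indicator (fun t => xUpdate η₀ η₁ t B) t := fun t => rfl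
    simp only [this]
    rw [setLIntegral_indicator measurableSet_Iio, Set.inter_comm, Set.Ioi_inter_Iio]
  · rw [ENNReal.ofReal_of_nonpos (not_lt.1 hx), zero_mul, eq_comm,
      setLIntegral_eq_zero measurableSet_Ioi]
    intro t ht
    exact Set.indicator_of_notMem (s := {p : ℝ × E | p.1 < η₁ p.2}) (a := (t, x))
      (fun h => hx (lt_trans ht h)) _

/-- Slice sampling is reversible with respect to its target distribution. -/
theorem isReversible_sliceKernel (h₀ : Measurable η₀) (h₁ : Measurable η₁)
    {ν : Measure E} (c : ℝ≥0∞) (hν : ν = volume.withDensity fun x =>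
      c * ENNReal.ofReal (η₀ x) * ENNReal.ofReal (η₁ x)) :
    Kernel.IsReversible (sliceKernel η₀ η₁ h₁) ν := by
  set μ := (volume : Measure E).withDensity fun y => ENNReal.ofReal (η₀ y) with hμ
  have hS : MeasurableSet {p : ℝ × E | p.1 < η₁ p.2} :=
    measurableSet_lt measurable_fst (h₁.comp measurable_snd)
  -- Exchanging the integrals over x and t leaves an expression symmetric in A and B.
  have key : ∀ A B : Set E, MeasurableSet A → MeasurableSet B →
      ∫⁻ x in A, sliceKernel η₀ η₁ h₁ x B ∂ν
        = c * ∫⁻ t in Set.Ioi 0, (μ {y | t < η₁ y})⁻¹ * μ ({y | t < η₁ y} ∩ B)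
          * μ ({y | t < η₁ y} ∩ A) := by
    intro A B hA hB
    have hPB := Kernel.measurable_coe (sliceKernel η₀ η₁ h₁) hB
    have hd : (volume : Measure E).withDensity (fun x =>
        c * ENNReal.ofReal (η₀ x) * ENNReal.ofReal (η₁ x))
        = c • μ.withDensity fun x => ENNReal.ofReal (η₁ x) := by
      rw [hμ, ← withDensity_mul _ h₀.ennreal_ofReal h₁.ennreal_ofReal,
        ← withDensity_smul _ (h₀.ennreal_ofReal.mul h₁.ennreal_ofReal)]
      congr 1
      ext x
      simp [mul_assoc]
    rw [hν, hd, Measure.restrict_smul, lintegral_smul_measure, smul_eq_mul,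
      setLIntegral_withDensity_eq_setLIntegral_mul _ h₁.ennreal_ofReal hPB hA]
    congr 1
    simp only [Pi.mul_apply, ofReal_mul_sliceKernel_apply h₁ _ hB]
    have hm : Measurable (fun p : ℝ × E => xUpdate η₀ η₁ p.1 B) :=
      ((Measure.measurable_coe hB).comp (measurable_xUpdate η₀ h₁)).comp measurable_fst
    rw [lintegral_lintegral_swap (f := fun x t => {p : ℝ × E | p.1 < η₁ p.2}.indicator
      (fun p => xUpdate η₀ η₁ p.1 B) (t, x)) ((hm.indicator hS).comp measurable_swap).aemeasurable]
    refine lintegral_congr fun t => ?_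
    have hSt : MeasurableSet {y | t < η₁ y} := measurableSet_lt measurable_const h₁
    have : ∀ x, {p : ℝ × E | p.1 < η₁ p.2}.indicator (fun p => xUpdate η₀ η₁ p.1 B) (t, x)
        = {y | t < η₁ y}.indicator (fun _ => xUpdate η₀ η₁ t B) x := fun x => rfl
    simp only [this]
    rw [lintegral_indicator hSt, lintegral_const, Measure.restrict_apply_univ,
      Measure.restrict_apply hSt]
    rw [xUpdate, cond_apply hSt]
  intro A B hA hB
  rw [key A B hA hB, key B A hB hA]
  congr 1
  refine lintegral_congr fun t => ?_
  rw [mul_assoc, mul_comm (μ _) (μ _), ← mul_assoc]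

theorem isMarkovKernel_sliceKernel (h₁ : Measurable η₁)
    (hX : ∀ x t, 0 < t → t < η₁ x → IsProbabilityMeasure (xUpdate η₀ η₁ t)) :
    IsMarkovKernel (sliceKernel η₀ η₁ h₁) := by
  refine ⟨fun x => ⟨?_⟩⟩
  by_cases hx : 0 < η₁ x
  · rw [sliceKernel_of_pos h₁ hx,
      Measure.bind_apply .univ (measurable_xUpdate η₀ h₁).aemeasurable, unifIoo_eq,
      lintegral_smul_measure, setLIntegral_congr_fun (g := fun _ => 1) measurableSet_Ioo
        (fun t ht => by have := hX x t ht.1 ht.2; exact measure_univ)]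
    simpa using ENNReal.inv_mul_cancel (by simpa using hx) (by simp)
  · have : sliceKernel η₀ η₁ h₁ x = Measure.dirac x := if_neg hx
    rw [this, measure_univ]

theorem integrable_integral_xUpdate (h₁ : Measurable η₁) {x : E} (hx : 0 < η₁ x) {f : E → ℝ}
    (hf : Integrable f (sliceKernel η₀ η₁ h₁ x)) :
    Integrable (fun t => ∫ y, f y ∂(xUpdate η₀ η₁ t)) (unifIoo (η₁ x)) := by
  rw [sliceKernel_of_pos h₁ hx] at hf
  exact Integrable.integral_comp (κ := Kernel.const Unit (unifIoo (η₁ x)))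
    (η := ⟨xUpdate η₀ η₁, measurable_xUpdate η₀ h₁⟩) (a := ()) hf

theorem kernelOp_sliceKernel (h₁ : Measurable η₁) {x : E} (hx : 0 < η₁ x) {f : E → ℝ}
    (hf : Integrable f (sliceKernel η₀ η₁ h₁ x)) :
    kernelOp (sliceKernel η₀ η₁ h₁) f x
      = ∫ u in (0 : ℝ)..1, ∫ y, f y ∂(xUpdate η₀ η₁ (η₁ x * u)) := by
  rw [kernelOp, ← integral_unifIoo hx (fun t => ∫ y, f y ∂(xUpdate η₀ η₁ t))]
  rw [sliceKernel_of_pos h₁ hx] at hf ⊢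
  exact Kernel.integral_comp (κ := Kernel.const Unit (unifIoo (η₁ x)))
    (η := ⟨xUpdate η₀ η₁, measurable_xUpdate η₀ h₁⟩) (a := ()) hf

end SliceKernel

/-! ### The weighted radial law on punctured balls. -/

section Radial

variable {d : ℕ}

/-- The measure with density `‖x‖^(k-d)`. -/
noncomputable def powerMeasure (d : ℕ) (k : ℝ) : Measure (EuclideanSpace ℝ (Fin d)) :=
  volume.withDensity fun y => ENNReal.ofReal (kpssFactor₀ d k y)

/-- The ball of radius `r` without its center. -/
def puncturedBall (d : ℕ) (r : ℝ) : Set (EuclideanSpace ℝ (Fin d)) := {y | 0 < ‖y‖ ∧ ‖y‖ < r}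

theorem measurableSet_puncturedBall (r : ℝ) : MeasurableSet (puncturedBall d r) :=
  (measurableSet_lt measurable_const measurable_norm).inter
    (measurableSet_lt measurable_norm measurable_const)

theorem measurable_kpssFactor₀ (k : ℝ) : Measurable (kpssFactor₀ d k) :=
  measurable_norm.pow_const _

theorem pow_pred_mul_rpow_sub (hd : 1 ≤ d) {s : ℝ} (hs : 0 < s) (a : ℝ) :
    s ^ (d - 1) * s ^ (a - d) = s ^ (a - 1) := by
  rw [← Real.rpow_natCast, ← Real.rpow_add hs, Nat.cast_sub hd]
  congr 1
  push_cast
  ring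

/-- Polar coordinates give s^(d-1)·s^(k-d) = s^(k-1); then substitute s = r z. -/
theorem setIntegral_puncturedBall (hd : 1 ≤ d) (k : ℝ) {r : ℝ} (hr : 0 < r) (F : ℝ → ℝ) :
    ∫ y in puncturedBall d r, F ‖y‖ ∂(powerMeasure d k)
      = d * volume.real (Metric.ball (0 : EuclideanSpace ℝ (Fin d)) 1) * r ^ k *
        ∫ z in (0 : ℝ)..1, z ^ (k - 1) * F (r * z) := by
  have : Nontrivial (EuclideanSpace ℝ (Fin d)) :=
    Module.nontrivial_of_finrank_pos (R := ℝ) (by rw [finrank_euclideanSpace_fin]; exact hd)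
  rw [← integral_indicator (measurableSet_puncturedBall r), powerMeasure,
    integral_withDensity_eq_integral_toReal_smul (measurable_kpssFactor₀ k).ennreal_ofReal (by simp)]
  have h1 : ∀ y : EuclideanSpace ℝ (Fin d),
      (ENNReal.ofReal (kpssFactor₀ d k y)).toReal •
        (puncturedBall d r).indicator (fun y => F ‖y‖) y
      = (fun s => (Set.Ioo 0 r).indicator (fun s => s ^ (k - d) * F s) s) ‖y‖ := by
    intro y
    rw [ENNReal.toReal_ofReal (show 0 ≤ kpssFactor₀ d k y from Real.rpow_nonneg (norm_nonneg _) _)]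
    by_cases hy : 0 < ‖y‖ ∧ ‖y‖ < r
    · rw [Set.indicator_of_mem (show y ∈ puncturedBall d r from hy)]
      simp only
      rw [Set.indicator_of_mem (show ‖y‖ ∈ Set.Ioo 0 r from hy)]
      rfl
    · rw [Set.indicator_of_notMem (show y ∉ puncturedBall d r from hy)]
      simp only
      rw [Set.indicator_of_notMem (show ‖y‖ ∉ Set.Ioo 0 r from hy), smul_zero]
  simp only [h1]
  rw [integral_fun_norm_addHaar volume, finrank_euclideanSpace_fin]
  have h2 : ∫ s in Set.Ioi (0 : ℝ), s ^ (d - 1) •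
      (Set.Ioo 0 r).indicator (fun s => s ^ (k - d) * F s) s
      = ∫ s in Set.Ioo 0 r, s ^ (k - 1) * F s := by
    have : ∀ s : ℝ, s ^ (d - 1) • (Set.Ioo 0 r).indicator (fun s => s ^ (k - d) * F s) s
        = (Set.Ioo 0 r).indicator (fun s => s ^ (k - 1) * F s) s := by
      intro s
      by_cases hs : s ∈ Set.Ioo 0 r
      · rw [Set.indicator_of_mem hs, Set.indicator_of_mem hs, smul_eq_mul, ← mul_assoc,
          pow_pred_mul_rpow_sub hd hs.1]
      · rw [Set.indicator_of_notMem hs, Set.indicator_of_notMem hs, smul_zero]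
    simp only [this]
    rw [setIntegral_indicator measurableSet_Ioo]
    congr 2
    ext s
    simp +contextual
  have h3 : ∫ s in Set.Ioo 0 r, s ^ (k - 1) * F s
      = r ^ k * ∫ z in (0 : ℝ)..1, z ^ (k - 1) * F (r * z) := by
    have h4 := intervalIntegral.smul_integral_comp_mul_left (a := 0) (b := 1)
      (fun s => s ^ (k - 1) * F s) r
    rw [smul_eq_mul, mul_zero, mul_one, intervalIntegral.integral_of_le hr.le, integral_Ioc_eq_integral_Ioo]
      at h4
    rw [← h4, ← intervalIntegral.integral_const_mul, ← intervalIntegral.integral_const_mul]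
    refine intervalIntegral.integral_congr fun z hz => ?_
    rw [Set.uIcc_of_le zero_le_one] at hz
    rw [Real.mul_rpow hr.le hz.1, Real.rpow_sub_one hr.ne']
    field_simp
  rw [h2, h3, nsmul_eq_mul, smul_eq_mul]
  ring

theorem integral_rpow_sub_one {a : ℝ} (ha : 0 < a) : ∫ z in (0 : ℝ)..1, z ^ (a - 1) = 1 / a := by
  rw [integral_rpow (Or.inl (by linarith))]
  simp [ha.ne']

theorem powerMeasure_real_puncturedBall (hd : 1 ≤ d) {k : ℝ} (hk : 0 < k) {r : ℝ} (hr : 0 < r) :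
    (powerMeasure d k).real (puncturedBall d r)
      = d * volume.real (Metric.ball (0 : EuclideanSpace ℝ (Fin d)) 1) * r ^ k * (1 / k) := by
  have := setIntegral_puncturedBall hd k hr (fun _ => 1)
  simpa [integral_rpow_sub_one hk] using this

theorem powerMeasure_real_puncturedBall_pos (hd : 1 ≤ d) {k : ℝ} (hk : 0 < k) {r : ℝ}
    (hr : 0 < r) : 0 < (powerMeasure d k).real (puncturedBall d r) := by
  rw [powerMeasure_real_puncturedBall hd hk hr]
  have h1 : 0 < volume.real (Metric.ball (0 : EuclideanSpace ℝ (Fin d)) 1) :=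
    ENNReal.toReal_pos (Metric.measure_ball_pos _ _ one_pos).ne' measure_ball_lt_top.ne
  have h2 : (0 : ℝ) < d := by exact_mod_cast hd
  positivity

theorem isProbabilityMeasure_cond_puncturedBall (hd : 1 ≤ d) {k : ℝ} (hk : 0 < k) {r : ℝ}
    (hr : 0 < r) :
    IsProbabilityMeasure (ProbabilityTheory.cond (powerMeasure d k) (puncturedBall d r)) := by
  have h := ENNReal.toReal_pos_iff.1 (powerMeasure_real_puncturedBall_pos hd hk hr)
  exact cond_isProbabilityMeasure_of_finite h.1.ne' h.2.ne

theorem integral_cond_puncturedBall (hd : 1 ≤ d) {k : ℝ} (hk : 0 < k) {r : ℝ} (hr : 0 < r)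
    (F : ℝ → ℝ) :
    ∫ y, F ‖y‖ ∂(ProbabilityTheory.cond (powerMeasure d k) (puncturedBall d r))
      = k * ∫ z in (0 : ℝ)..1, z ^ (k - 1) * F (r * z) := by
  have hpos := powerMeasure_real_puncturedBall_pos hd hk hr
  rw [ProbabilityTheory.cond, integral_smul_measure, setIntegral_puncturedBall hd k hr,
    ENNReal.toReal_inv, smul_eq_mul]
  change ((powerMeasure d k).real (puncturedBall d r))⁻¹ * _ = _
  rw [powerMeasure_real_puncturedBall hd hk hr] at hpos ⊢
  have h1 : (d : ℝ) * volume.real (Metric.ball (0 : EuclideanSpace ℝ (Fin d)) 1) * r ^ k ≠ 0 :=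
    (pos_of_mul_pos_left hpos (by positivity)).ne'
  rw [mul_inv, one_div, inv_inv, mul_mul_mul_comm, inv_mul_cancel₀ h1, one_mul]

/-- Both integrals are expectations of F(p·Z^m), with p = q or q' and the same Z; the constant is
E[Z^m] = k/(k+m). -/
theorem abs_integral_cond_puncturedBall_sub_le (hd : 1 ≤ d) {k m : ℝ} (hk : 0 < k) (hm : 0 < m)
    {F : ℝ → ℝ} {K : NNReal} (hF : LipschitzWith K F) {q q' : ℝ} (hq : 0 < q) (hq' : 0 < q') :
    |∫ y, F (‖y‖ ^ m) ∂(ProbabilityTheory.cond (powerMeasure d k) (puncturedBall d (q ^ m⁻¹)))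
      - ∫ y, F (‖y‖ ^ m) ∂(ProbabilityTheory.cond (powerMeasure d k)
        (puncturedBall d (q' ^ m⁻¹)))|
      ≤ k / (k + m) * K * |q - q'| := by
  have hint : ∀ p : ℝ, 0 < p → ∫ y, F (‖y‖ ^ m) ∂(ProbabilityTheory.cond (powerMeasure d k)
      (puncturedBall d (p ^ m⁻¹))) = k * ∫ z in (0 : ℝ)..1, z ^ (k - 1) * F (p * z ^ m) := by
    intro p hp
    rw [integral_cond_puncturedBall hd hk (Real.rpow_pos_of_pos hp _) (fun s => F (s ^ m))]
    congr 1
    refine intervalIntegral.integral_congr fun z hz => ?_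
    rw [Set.uIcc_of_le zero_le_one] at hz
    rw [Real.mul_rpow (Real.rpow_nonneg hp.le _) hz.1, Real.rpow_inv_rpow hp.le hm.ne']
  have hii : ∀ p : ℝ, IntervalIntegrable (fun z => z ^ (k - 1) * F (p * z ^ m)) volume 0 1 := by
    intro p
    refine (intervalIntegral.intervalIntegrable_rpow' (by linarith)).mul_continuousOn ?_
    exact (hF.continuous.comp (continuous_const.mul
      (Real.continuous_rpow_const hm.le))).continuousOn
  rw [hint q hq, hint q' hq', ← mul_sub, ← intervalIntegral.integral_sub (hii q) (hii q'), abs_mul,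
    abs_of_pos hk]
  have hbound : |∫ z in (0 : ℝ)..1, (z ^ (k - 1) * F (q * z ^ m) - z ^ (k - 1) * F (q' * z ^ m))|
      ≤ ∫ z in (0 : ℝ)..1, K * |q - q'| * z ^ (k + m - 1) := by
    have hg : IntervalIntegrable (fun z : ℝ => K * |q - q'| * z ^ (k + m - 1)) volume 0 1 :=
      (intervalIntegral.intervalIntegrable_rpow' (by linarith)).const_mul _
    rw [← Real.norm_eq_abs]
    refine intervalIntegral.norm_integral_le_of_norm_le zero_le_one (ae_of_all _ fun z hz => ?_) hg
    have h1 : |F (q * z ^ m) - F (q' * z ^ m)| ≤ K * (|q - q'| * z ^ m) := by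
      have := hF.norm_sub_le (q * z ^ m) (q' * z ^ m)
      rwa [← sub_mul, norm_mul, Real.norm_eq_abs, Real.norm_eq_abs, Real.norm_eq_abs,
        abs_of_nonneg (Real.rpow_nonneg hz.1.le m)] at this
    rw [← mul_sub, norm_mul, Real.norm_of_nonneg (Real.rpow_nonneg hz.1.le _), Real.norm_eq_abs]
    calc _ ≤ z ^ (k - 1) * (K * (|q - q'| * z ^ m)) :=
          mul_le_mul_of_nonneg_left h1 (Real.rpow_nonneg hz.1.le _)
      _ = _ := by
          rw [show k + m - 1 = k - 1 + m by ring, Real.rpow_add hz.1]; ring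
  rw [intervalIntegral.integral_const_mul, integral_rpow_sub_one (by positivity)] at hbound
  calc _ ≤ k * (K * |q - q'| * (1 / (k + m))) := mul_le_mul_of_nonneg_left hbound hk.le
    _ = _ := by ring

end Radial

/-! ### Level sets and growth of convex increasing functions. -/

section Convex

open Set

theorem exists_mem_openInterval {κ : EReal} (hκ : 0 < κ) : ∃ v, v ∈ openInterval κ := by
  obtain ⟨v, h0, h1⟩ := EReal.lt_iff_exists_real_btwn.1 hκ
  exact ⟨v, by exact_mod_cast h0, h1⟩

theorem mem_openInterval_of_le {κ : EReal} {v w : ℝ} (hw : w ∈ openInterval κ) (h0 : 0 < v)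
    (hvw : v ≤ w) : v ∈ openInterval κ :=
  ⟨h0, (EReal.coe_le_coe_iff.2 hvw).trans_lt hw.2⟩

theorem exists_gt_mem_openInterval {κ : EReal} {v : ℝ} (hv : v ∈ openInterval κ) :
    ∃ w ∈ openInterval κ, v < w := by
  obtain ⟨w, h0, h1⟩ := EReal.lt_iff_exists_real_btwn.1 hv.2
  have h0' : v < w := by exact_mod_cast h0
  exact ⟨w, ⟨hv.1.trans h0', h1⟩, h0'⟩

theorem isOpen_openInterval (κ : EReal) : IsOpen (openInterval κ) :=
  (isOpen_lt continuous_const continuous_id).inter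
    (isOpen_lt continuous_coe_real_ereal continuous_const)

theorem exists_ge_of_tendsto_openInterval {κ : EReal} (hκ : 0 < κ) {φ : ℝ → ℝ}
    (hlim : Filter.Tendsto φ
      (Filter.comap (fun r : ℝ => (r : EReal)) (nhdsWithin κ (Iio κ))) Filter.atTop) (s : ℝ) :
    ∃ w ∈ openInterval κ, s ≤ φ w := by
  obtain ⟨U, hU, hUs⟩ := Filter.mem_comap.1 (hlim (Filter.Ici_mem_atTop s))
  obtain ⟨l, hl, hlU⟩ := (mem_nhdsLT_iff_exists_Ioo_subset' hκ).1 hU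
  obtain ⟨w, h0, h1⟩ := EReal.lt_iff_exists_real_btwn.1 (max_lt hl hκ)
  have h0' := max_lt_iff.1 h0
  exact ⟨w, ⟨by exact_mod_cast h0'.2, h1⟩, hUs (hlU ⟨h0'.1, h1⟩)⟩

/-- A convex function is continuous on an open interval, so divergence at κ and the intermediate
value theorem give every level above φ(v). -/
theorem exists_eq_add_of_convexOn {κ : EReal} (hκ : 0 < κ) {φ : ℝ → ℝ}
    (hconv : ConvexOn ℝ (openInterval κ) φ)
    (hlim : Filter.Tendsto φ
      (Filter.comap (fun r : ℝ => (r : EReal)) (nhdsWithin κ (Iio κ))) Filter.atTop)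
    {v : ℝ} (hv : v ∈ openInterval κ) {s : ℝ} (hs : φ v ≤ s) :
    ∃ q ∈ openInterval κ, φ q = s := by
  obtain ⟨w, hw, hsw⟩ := exists_ge_of_tendsto_openInterval hκ hlim s
  have hc : ContinuousOn φ (openInterval κ) := hconv.continuousOn (isOpen_openInterval κ)
  exact hconv.1.isPreconnected.intermediate_value hv hw hc ⟨hs, hsw⟩

/-- Equal increments of a convex, strictly increasing function are attained over intervals whose
length decreases with their position. -/
theorem abs_sub_le_of_convexOn {S : Set ℝ} {φ : ℝ → ℝ} (hmono : StrictMonoOn φ S)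
    (hconv : ConvexOn ℝ S φ) {v w p q : ℝ} (hv : v ∈ S) (hw : w ∈ S) (hp : p ∈ S) (hq : q ∈ S)
    {e : ℝ} (he : 0 < e) (hpe : φ p = φ v + e) (hqe : φ q = φ w + e) : |p - q| ≤ |v - w| := by
  wlog hvw : v < w generalizing v w p q
  · rcases eq_or_lt_of_le (not_lt.1 hvw) with rfl | h
    · rw [hmono.injOn hp hq (hpe.trans hqe.symm)]; simp
    · rw [abs_sub_comm p, abs_sub_comm v]; exact this hw hv hq hp hqe hpe h
  have hvp : v < p := (hmono.lt_iff_lt hv hp).1 (by linarith)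
  have hwq : w < q := (hmono.lt_iff_lt hw hq).1 (by linarith)
  have hφvw := hmono hv hw hvw
  have hpq : p < q := (hmono.lt_iff_lt hp hq).1 (by linarith)
  rw [abs_sub_comm p, abs_sub_comm v, abs_of_pos (sub_pos.2 hpq), abs_of_pos (sub_pos.2 hvw)]
  -- Secant slopes satisfy slope[v,w] ≤ slope[v,q] ≤ slope[p,q]. The outer two have equal rises, so
  -- the run q - p is at most w - v.
  have h1 : (φ w - φ v) / (w - v) ≤ (φ q - φ v) / (q - v) :=
    hconv.secant_mono hv hw hq hvw.ne' (hvw.trans hwq).ne' hwq.le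
  have h2 : (φ v - φ q) / (v - q) ≤ (φ p - φ q) / (p - q) :=
    hconv.secant_mono hq hv hp (hvw.trans hwq).ne hpq.ne hvp.le
  rw [← neg_sub (φ q), ← neg_sub q v, neg_div_neg_eq, ← neg_sub (φ q) (φ p), ← neg_sub q p,
    neg_div_neg_eq] at h2
  have h3 := h1.trans h2
  rw [show φ q - φ p = φ w - φ v by linarith] at h3
  exact (div_le_div_iff_of_pos_left (sub_pos.2 hφvw) (sub_pos.2 hvw) (sub_pos.2 hpq)).1 h3

/-- Outside two points a < b the function lies above their secant; between them monotonicity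
suffices, at the cost of α·b in β. This supplies the tail bound for the second moment of V. -/
theorem exists_linear_le_of_convexOn {κ : EReal} (hκ : 0 < κ) {φ : ℝ → ℝ}
    (hmono : StrictMonoOn φ (openInterval κ)) (hconv : ConvexOn ℝ (openInterval κ) φ) :
    ∃ α β : ℝ, 0 < α ∧ ∀ v ∈ openInterval κ, α * v - β ≤ φ v := by
  obtain ⟨a, ha⟩ := exists_mem_openInterval hκ
  obtain ⟨b, hb, hab⟩ := exists_gt_mem_openInterval ha
  set α := (φ b - φ a) / (b - a) with hα
  have hα0 : 0 < α := div_pos (sub_pos.2 (hmono ha hb hab)) (sub_pos.2 hab)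
  have hαb : 0 < α * b := mul_pos hα0 hb.1
  refine ⟨α, α * a - φ a + α * b, hα0, fun v hv => ?_⟩
  rcases lt_trichotomy v a with hva | rfl | hva
  · have h := hconv.secant_mono ha hv hb hva.ne hab.ne' (hva.trans hab).le
    rw [← hα, div_le_iff_of_neg (by linarith)] at h
    linarith
  · linarith
  · rcases le_or_gt b v with hbv | hbv
    · have h := hconv.secant_mono ha hb hv hab.ne' hva.ne' hbv
      rw [← hα, le_div_iff₀ (by linarith)] at h
      linarith
    · have h1 := hmono ha hv hva
      have h2 := mul_lt_mul_of_pos_left hbv hα0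
      have h3 := mul_pos hα0 ha.1
      linarith

end Convex

/-! ### Polar slices, the coupling bound and moments. -/

section RadialSlice

variable {d : ℕ} {k m : ℝ} {κ : EReal} {φ : ℝ → ℝ} {ϱ : EuclideanSpace ℝ (Fin d) → ℝ}

theorem radial_density_apply (hd : 1 ≤ d) (hϱ : ∀ r : ℝ, 0 ≤ r →
      ∀ θ ∈ Metric.sphere (0 : EuclideanSpace ℝ (Fin d)) 1, ϱ (r • θ) =
        r ^ (k - d) * Real.exp (-φ (r ^ m)) * (openInterval κ).indicator 1 (r ^ m))
    (x : EuclideanSpace ℝ (Fin d)) :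
    ϱ x = ‖x‖ ^ (k - d) * (openInterval κ).indicator (fun v => Real.exp (-φ v)) (‖x‖ ^ m) := by
  have key : ∃ θ ∈ Metric.sphere (0 : EuclideanSpace ℝ (Fin d)) 1, ‖x‖ • θ = x := by
    rcases eq_or_ne x 0 with rfl | hx
    · exact ⟨EuclideanSpace.single ⟨0, hd⟩ 1, by simp, by simp⟩
    · refine ⟨‖x‖⁻¹ • x, ?_, ?_⟩
      · simp [norm_smul, hx]
      · rw [smul_smul, mul_inv_cancel₀ (norm_ne_zero_iff.2 hx), one_smul]
  obtain ⟨θ, hθ, hx⟩ := key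
  have h := hϱ ‖x‖ (norm_nonneg x) θ hθ
  rw [hx] at h
  rw [h]
  by_cases hv : ‖x‖ ^ m ∈ openInterval κ
  · simp [hv]
  · simp [hv]

theorem norm_pos_of_rpow_mem (hm : 0 < m) {x : EuclideanSpace ℝ (Fin d)}
    (hx : ‖x‖ ^ m ∈ openInterval κ) : 0 < ‖x‖ := by
  refine (norm_nonneg x).lt_of_ne fun h => ?_
  have := hx.1
  rw [← h, Real.zero_rpow hm.ne'] at this
  exact this.false

theorem kpssFactor₁_apply (hm : 0 < m)
    (hη : ∀ x, ϱ x = ‖x‖ ^ (k - d) *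
      (openInterval κ).indicator (fun v => Real.exp (-φ v)) (‖x‖ ^ m))
    (x : EuclideanSpace ℝ (Fin d)) :
    kpssFactor₁ k ϱ x = (openInterval κ).indicator (fun v => Real.exp (-φ v)) (‖x‖ ^ m) := by
  rw [kpssFactor₁, hη]
  by_cases hv : ‖x‖ ^ m ∈ openInterval κ
  · rw [← mul_assoc, ← Real.rpow_add (norm_pos_of_rpow_mem hm hv)]
    simp
  · rw [Set.indicator_of_notMem hv, mul_zero, mul_zero]

theorem kpssFactor₁_pos_iff (hm : 0 < m)
    (hη : ∀ x, ϱ x = ‖x‖ ^ (k - d) *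
      (openInterval κ).indicator (fun v => Real.exp (-φ v)) (‖x‖ ^ m))
    (x : EuclideanSpace ℝ (Fin d)) : 0 < kpssFactor₁ k ϱ x ↔ ‖x‖ ^ m ∈ openInterval κ := by
  rw [kpssFactor₁_apply hm hη]
  by_cases hv : ‖x‖ ^ m ∈ openInterval κ
  · simp [hv, Real.exp_pos]
  · simp [hv]

/-- Since φ is strictly increasing, exceeding exp(-φ(q)) means V < q. The origin drops out because V
= 0 is outside the open interval. -/
theorem xUpdate_eq_cond_puncturedBall (hm : 0 < m) (hmono : StrictMonoOn φ (openInterval κ))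
    (hη : ∀ x, ϱ x = ‖x‖ ^ (k - d) *
      (openInterval κ).indicator (fun v => Real.exp (-φ v)) (‖x‖ ^ m))
    {q : ℝ} (hq : q ∈ openInterval κ) :
    xUpdate (kpssFactor₀ d k) (kpssFactor₁ k ϱ) (Real.exp (-φ q))
      = ProbabilityTheory.cond (powerMeasure d k) (puncturedBall d (q ^ m⁻¹)) := by
  rw [xUpdate, ← powerMeasure]
  congr 1
  ext y
  change Real.exp (-φ q) < kpssFactor₁ k ϱ y ↔ 0 < ‖y‖ ∧ ‖y‖ < q ^ m⁻¹
  rw [kpssFactor₁_apply hm hη, Real.lt_rpow_inv_iff_of_pos (norm_nonneg y) hq.1.le hm]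
  by_cases hv : ‖y‖ ^ m ∈ openInterval κ
  · rw [Set.indicator_of_mem hv, Real.exp_lt_exp, neg_lt_neg_iff, hmono.lt_iff_lt hv hq]
    simp [norm_pos_of_rpow_mem hm hv]
  · rw [Set.indicator_of_notMem hv]
    refine iff_of_false (Real.exp_pos _).not_gt fun h => hv ?_
    exact mem_openInterval_of_le hq (Real.rpow_pos_of_pos h.1 m) h.2.le

/-- Each level below η₁(x) is exp(-φ(q)) for some q, so its slice is a punctured ball of positive
finite mass. -/
theorem isMarkovKernel_kpssKernel (hd : 1 ≤ d) (hk : 0 < k) (hm : 0 < m) (hκ : 0 < κ)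
    (hmono : StrictMonoOn φ (openInterval κ)) (hconv : ConvexOn ℝ (openInterval κ) φ)
    (hlim : Filter.Tendsto φ
      (Filter.comap (fun r : ℝ => (r : EReal)) (nhdsWithin κ (Set.Iio κ))) Filter.atTop)
    (hϱm : Measurable ϱ)
    (hη : ∀ x, ϱ x = ‖x‖ ^ (k - d) *
      (openInterval κ).indicator (fun v => Real.exp (-φ v)) (‖x‖ ^ m)) :
    IsMarkovKernel (kpssKernel k ϱ hϱm) := by
  refine isMarkovKernel_sliceKernel _ fun x t ht htx => ?_
  have hv := (kpssFactor₁_pos_iff hm hη x).1 (ht.trans htx)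
  rw [kpssFactor₁_apply hm hη, Set.indicator_of_mem hv] at htx
  have hs : φ (‖x‖ ^ m) ≤ -Real.log t := by
    have := Real.log_lt_log ht htx
    rw [Real.log_exp] at this
    linarith
  obtain ⟨q, hq, hqs⟩ := exists_eq_add_of_convexOn hκ hconv hlim hv hs
  have htq : t = Real.exp (-φ q) := by rw [hqs, neg_neg, Real.exp_log ht]
  rw [htq, xUpdate_eq_cond_puncturedBall hm hmono hη hq]
  exact isProbabilityMeasure_cond_puncturedBall hd hk (Real.rpow_pos_of_pos hq.1 _)

theorem isReversible_kpssKernel (hm : 0 < m) (hϱm : Measurable ϱ)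
    (hη : ∀ x, ϱ x = ‖x‖ ^ (k - d) *
      (openInterval κ).indicator (fun v => Real.exp (-φ v)) (‖x‖ ^ m))
    {c : ℝ} (hc : 0 < c) :
    Kernel.IsReversible (kpssKernel k ϱ hϱm)
      (volume.withDensity fun x => ENNReal.ofReal (c * ϱ x)) := by
  refine isReversible_sliceKernel (measurable_kpssFactor₀ k) _ (ENNReal.ofReal c) ?_
  congr 1
  ext x
  rw [mul_assoc, ← ENNReal.ofReal_mul (show 0 ≤ kpssFactor₀ d k x from Real.rpow_nonneg (norm_nonneg x) _),
    ← ENNReal.ofReal_mul hc.le, kpssFactor₁_apply hm hη, hη]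
  rfl

theorem abs_kernelOp_kpssKernel_sub_le (hd : 1 ≤ d) (hk : 0 < k) (hm : 0 < m) (hκ : 0 < κ)
    (hmono : StrictMonoOn φ (openInterval κ)) (hconv : ConvexOn ℝ (openInterval κ) φ)
    (hlim : Filter.Tendsto φ
      (Filter.comap (fun r : ℝ => (r : EReal)) (nhdsWithin κ (Set.Iio κ))) Filter.atTop)
    (hϱm : Measurable ϱ)
    (hη : ∀ x, ϱ x = ‖x‖ ^ (k - d) *
      (openInterval κ).indicator (fun v => Real.exp (-φ v)) (‖x‖ ^ m))
    {F : ℝ → ℝ} {K : NNReal} (hF : LipschitzWith K F) {x x' : EuclideanSpace ℝ (Fin d)}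
    (hx : ‖x‖ ^ m ∈ openInterval κ) (hx' : ‖x'‖ ^ m ∈ openInterval κ)
    (hFx : Integrable (fun y => F (‖y‖ ^ m)) (kpssKernel k ϱ hϱm x))
    (hFx' : Integrable (fun y => F (‖y‖ ^ m)) (kpssKernel k ϱ hϱm x')) :
    |kernelOp (kpssKernel k ϱ hϱm) (fun y => F (‖y‖ ^ m)) x
      - kernelOp (kpssKernel k ϱ hϱm) (fun y => F (‖y‖ ^ m)) x'|
      ≤ k / (k + m) * K * |‖x‖ ^ m - ‖x'‖ ^ m| := by
  have hpos := (kpssFactor₁_pos_iff hm hη x).2 hx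
  have hpos' := (kpssFactor₁_pos_iff hm hη x').2 hx'
  have hi := intervalIntegrable_of_integrable_unifIoo hpos (integrable_integral_xUpdate _ hpos hFx)
  have hi' :=
    intervalIntegrable_of_integrable_unifIoo hpos' (integrable_integral_xUpdate _ hpos' hFx')
  rw [kpssKernel, kernelOp_sliceKernel _ hpos hFx, kernelOp_sliceKernel _ hpos' hFx',
    ← intervalIntegral.integral_sub hi hi', ← Real.norm_eq_abs]
  refine (intervalIntegral.norm_integral_le_of_norm_le_const_ae
    (C := k / (k + m) * K * |‖x‖ ^ m - ‖x'‖ ^ m|) ?_).trans (by simp)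
  -- Excluding u = 1 makes the increment -log u strictly positive, as the convexity lemma requires.
  have hne : ∀ᵐ u : ℝ, u ≠ 1 := by simp [ae_iff]
  filter_upwards [hne] with u hu1 hu
  rw [Set.uIoc_of_le zero_le_one] at hu
  have hu1' : u < 1 := hu.2.lt_of_ne hu1
  have he : 0 < -Real.log u := neg_pos.2 (Real.log_neg hu.1 hu1')
  obtain ⟨q, hq, hqs⟩ := exists_eq_add_of_convexOn hκ hconv hlim hx
    (s := φ (‖x‖ ^ m) + -Real.log u) (by linarith)
  obtain ⟨q', hq', hqs'⟩ := exists_eq_add_of_convexOn hκ hconv hlim hx'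
    (s := φ (‖x'‖ ^ m) + -Real.log u) (by linarith)
  have ht : ∀ {z : EuclideanSpace ℝ (Fin d)} {p : ℝ}, ‖z‖ ^ m ∈ openInterval κ →
      φ p = φ (‖z‖ ^ m) + -Real.log u → kpssFactor₁ k ϱ z * u = Real.exp (-φ p) := by
    intro z p hz hp
    rw [kpssFactor₁_apply hm hη, Set.indicator_of_mem hz, hp, neg_add, neg_neg, Real.exp_add,
      Real.exp_log hu.1]
  rw [ht hx hqs, ht hx' hqs', xUpdate_eq_cond_puncturedBall hm hmono hη hq,
    xUpdate_eq_cond_puncturedBall hm hmono hη hq', Real.norm_eq_abs]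
  refine (abs_integral_cond_puncturedBall_sub_le hd hk hm hF hq.1 hq'.1).trans ?_
  exact mul_le_mul_of_nonneg_left (abs_sub_le_of_convexOn hmono hconv hx hx' hq hq' he hqs hqs')
    (by positivity)

theorem kpssKernel_congr_norm (hm : 0 < m) (hϱm : Measurable ϱ)
    (hη : ∀ x, ϱ x = ‖x‖ ^ (k - d) *
      (openInterval κ).indicator (fun v => Real.exp (-φ v)) (‖x‖ ^ m))
    {x x' : EuclideanSpace ℝ (Fin d)} (hx : ‖x‖ ^ m ∈ openInterval κ) (hxx' : ‖x‖ = ‖x'‖) :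
    kpssKernel k ϱ hϱm x = kpssKernel k ϱ hϱm x' := by
  have h : kpssFactor₁ k ϱ x = kpssFactor₁ k ϱ x' := by
    rw [kpssFactor₁_apply hm hη, kpssFactor₁_apply hm hη, hxx']
  have hpos := (kpssFactor₁_pos_iff hm hη x).2 hx
  rw [kpssKernel, sliceKernel_of_pos _ hpos, sliceKernel_of_pos _ (h ▸ hpos), h]

theorem ae_rpow_norm_mem_openInterval
    (hη : ∀ x, ϱ x = ‖x‖ ^ (k - d) *
      (openInterval κ).indicator (fun v => Real.exp (-φ v)) (‖x‖ ^ m))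
    (hϱm : Measurable ϱ) (c : ℝ) :
    ∀ᵐ x ∂((volume : Measure (EuclideanSpace ℝ (Fin d))).withDensity
      fun x => ENNReal.ofReal (c * ϱ x)), ‖x‖ ^ m ∈ openInterval κ := by
  rw [ae_withDensity_iff (hϱm.const_mul c).ennreal_ofReal]
  refine ae_of_all _ fun x hx => by_contra fun hv => hx ?_
  rw [hη, Set.indicator_of_notMem hv]
  simp

theorem memLp_rpow_norm (hd : 1 ≤ d) (hk : 0 < k) (hm : 0 < m) (hκ : 0 < κ)
    (hmono : StrictMonoOn φ (openInterval κ)) (hconv : ConvexOn ℝ (openInterval κ) φ)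
    (hϱm : Measurable ϱ) (hϱ0 : ∀ x, 0 ≤ ϱ x)
    (hη : ∀ x, ϱ x = ‖x‖ ^ (k - d) *
      (openInterval κ).indicator (fun v => Real.exp (-φ v)) (‖x‖ ^ m))
    {c : ℝ} (hc : 0 < c) :
    MemLp (fun x => ‖x‖ ^ m) 2 ((volume : Measure (EuclideanSpace ℝ (Fin d))).withDensity
      fun x => ENNReal.ofReal (c * ϱ x)) := by
  have : Nontrivial (EuclideanSpace ℝ (Fin d)) :=
    Module.nontrivial_of_finrank_pos (R := ℝ) (by rw [finrank_euclideanSpace_fin]; exact hd)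
  obtain ⟨α, β, hα, hαβ⟩ := exists_linear_le_of_convexOn hκ hmono hconv
  have hVm : Measurable fun x : EuclideanSpace ℝ (Fin d) => ‖x‖ ^ m := measurable_norm.pow_const _
  rw [memLp_two_iff_integrable_sq hVm.aestronglyMeasurable,
    integrable_withDensity_iff_integrable_smul' (hϱm.const_mul c).ennreal_ofReal (by simp)]
  have hdom : Integrable (fun x : EuclideanSpace ℝ (Fin d) => c * Real.exp β *
      (‖x‖ ^ (2 * m + k - d) * Real.exp (-α * ‖x‖ ^ m))) := by
    refine Integrable.const_mul ?_ _
    rw [integrable_fun_norm_addHaar volume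
      (f := fun s => s ^ (2 * m + k - d) * Real.exp (-α * s ^ m)), finrank_euclideanSpace_fin]
    -- The radial Jacobian s^(d-1) turns the exponent 2m + k - d into 2m + k - 1 > -1.
    refine (integrableOn_rpow_mul_exp_neg_mul_rpow (s := 2 * m + k - 1) (p := m) (by linarith) hm
      hα).congr_fun (fun s hs => ?_) measurableSet_Ioi
    simp only
    rw [smul_eq_mul, ← mul_assoc, pow_pred_mul_rpow_sub hd hs]
  refine hdom.mono' ((hϱm.const_mul c).ennreal_ofReal.ennreal_toReal.smul
    (hVm.pow_const 2)).aestronglyMeasurable (ae_of_all _ fun x => ?_)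
  rw [ENNReal.toReal_ofReal (mul_nonneg hc.le (hϱ0 x)), smul_eq_mul, Real.norm_of_nonneg
    (mul_nonneg (mul_nonneg hc.le (hϱ0 x)) (sq_nonneg _)), hη x]
  by_cases hv : ‖x‖ ^ m ∈ openInterval κ
  · have hx := norm_pos_of_rpow_mem hm hv
    rw [Set.indicator_of_mem hv]
    have h1 : Real.exp (-φ (‖x‖ ^ m)) ≤ Real.exp β * Real.exp (-α * ‖x‖ ^ m) := by
      rw [← Real.exp_add, Real.exp_le_exp]
      linarith [hαβ _ hv]
    have h2 : ‖x‖ ^ (2 * m + k - d) = ‖x‖ ^ (k - d) * (‖x‖ ^ m) ^ 2 := by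
      rw [← Real.rpow_mul_natCast hx.le, ← Real.rpow_add hx]
      congr 1
      push_cast
      ring
    rw [h2]
    calc c * (‖x‖ ^ (k - d) * Real.exp (-φ (‖x‖ ^ m))) * (‖x‖ ^ m) ^ 2
        = c * (‖x‖ ^ (k - d) * (‖x‖ ^ m) ^ 2) * Real.exp (-φ (‖x‖ ^ m)) := by ring
      _ ≤ c * (‖x‖ ^ (k - d) * (‖x‖ ^ m) ^ 2) * (Real.exp β * Real.exp (-α * ‖x‖ ^ m)) := by
          gcongr
      _ = _ := by ring
  · rw [Set.indicator_of_notMem hv]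
    simp only [mul_zero, zero_mul]
    positivity

end RadialSlice

/-! ### The spectral gap bound. -/

theorem theorem3p4 (d : ℕ) (hd : 1 ≤ d) (k m : ℝ) (hk : 0 < k) (hm : 0 < m)
    (κ : EReal) (hκ : 0 < κ) (φ : ℝ → ℝ)
    (hφ_mono : StrictMonoOn φ (openInterval κ))
    (hφ_convex : ConvexOn ℝ (openInterval κ) φ)
    (hφ_lim : Filter.Tendsto φ
      (Filter.comap (fun r : ℝ => (r : EReal)) (nhdsWithin κ (Set.Iio κ))) Filter.atTop)
    (π : Measure (EuclideanSpace ℝ (Fin d))) [IsProbabilityMeasure π]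
    (ϱ : EuclideanSpace ℝ (Fin d) → ℝ) (hπ : HasUnnormalizedDensity π ϱ)
    (hϱ : ∀ r : ℝ, 0 ≤ r → ∀ θ ∈ Metric.sphere (0 : EuclideanSpace ℝ (Fin d)) 1,
      ϱ (r • θ) =
        r ^ (k - d) * Real.exp (-φ (r ^ m)) * (openInterval κ).indicator 1 (r ^ m)) :
    IsMarkovKernel (kpssKernel k ϱ hπ.measurable) ∧
    Kernel.Invariant (kpssKernel k ϱ hπ.measurable) π ∧
    ((m / (k + m) : ℝ) : EReal) ≤ spectralGap (kpssKernel k ϱ hπ.measurable) π := by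
  have hη := radial_density_apply hd hϱ
  obtain ⟨c, hc, hπc⟩ := hπ.exists_const
  have hM := isMarkovKernel_kpssKernel hd hk hm hκ hφ_mono hφ_convex hφ_lim hπ.measurable hη
  set P := kpssKernel k ϱ hπ.measurable
  have hrev : Kernel.IsReversible P π := by
    rw [hπc]; exact isReversible_kpssKernel hm hπ.measurable hη hc
  set V : EuclideanSpace ℝ (Fin d) → ℝ := fun x => ‖x‖ ^ m with hV
  have hVm : Measurable V := measurable_norm.pow_const _
  have hVL : MemLp V 2 π := by
    rw [hπc]
    exact memLp_rpow_norm hd hk hm hκ hφ_mono hφ_convex hπ.measurable hπ.nonneg hη hc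
  have hVmem : ∀ᵐ x ∂π, V x ∈ openInterval κ := by
    rw [hπc]; exact ae_rpow_norm_mem_openInterval hη hπ.measurable c
  have hVint : ∀ᵐ x ∂π, Integrable V (P x) :=
    ae_integrable_kernel hrev.invariant (hVL.integrable (by norm_num))
  -- A measurable right inverse of V on [0,∞) along a fixed ray; P(x,·) = P(σ(V x),·) expresses P f
  -- as a function of V.
  set σ : ℝ → EuclideanSpace ℝ (Fin d) :=
    fun v => v ^ m⁻¹ • EuclideanSpace.single ⟨0, hd⟩ (1 : ℝ) with hσ
  have hσm : Measurable σ := (measurable_id.pow_const _).smul_const _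
  have hσn : ∀ v, 0 ≤ v → ‖σ v‖ = v ^ m⁻¹ := fun v hv => by
    simp [hσ, norm_smul, abs_of_nonneg (Real.rpow_nonneg hv _)]
  have hσV : ∀ v, 0 ≤ v → ‖σ v‖ ^ m = v := fun v hv => by
    rw [hσn v hv, Real.rpow_inv_rpow hv hm.ne']
  have hPσ : ∀ x, V x ∈ openInterval κ → P x = P (σ (V x)) := fun x hx => by
    refine kpssKernel_congr_norm hm hπ.measurable hη hx ?_
    rw [hσn _ hx.1.le, hV, Real.rpow_rpow_inv (norm_nonneg x) hm.ne']
  set C : NNReal := ⟨k / (k + m), by positivity⟩ with hC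
  have hnorm := norm_centeredKernelL2_le hrev hVm hVL (c := C) (by
      rw [← NNReal.coe_pos]; change 0 < k / (k + m); positivity) (by
    intro K F hF
    -- Off S the integral of F ∘ V could take its default value 0 and break the estimate. Almost
    -- every V(x) lies in S, so a Lipschitz extension from S to ℝ suffices.
    set S : Set ℝ := {v | v ∈ openInterval κ ∧ Integrable V (P (σ v))} with hS
    have hFi : ∀ v ∈ S, Integrable (F ∘ V) (P (σ v)) := fun v hv => by
      refine ((integrable_const ‖F 0‖).add (hv.2.norm.const_mul K)).mono'
        (hF.continuous.measurable.comp hVm).aestronglyMeasurable (ae_of_all _ fun y => ?_)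
      have h1 := hF.norm_sub_le (V y) 0
      have h2 := norm_add_le (F 0) (F (V y) - F 0)
      rw [add_sub_cancel] at h2
      rw [sub_zero] at h1
      exact h2.trans (by simpa using h1)
    have hLS : LipschitzOnWith (C * K) (fun v => kernelOp P (F ∘ V) (σ v)) S := by
      refine LipschitzOnWith.of_dist_le_mul fun v hv w hw => ?_
      have h1 := hσV v hv.1.1.le
      have h2 := hσV w hw.1.1.le
      have := abs_kernelOp_kpssKernel_sub_le hd hk hm hκ hφ_mono hφ_convex hφ_lim hπ.measurable hη
        hF (x := σ v) (x' := σ w) (by rw [h1]; exact hv.1) (by rw [h2]; exact hw.1)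
        (hFi v hv) (hFi w hw)
      rw [h1, h2] at this
      exact this
    obtain ⟨F', hF', heq⟩ := hLS.extend_real
    refine ⟨F', hF', ?_⟩
    filter_upwards [hVmem, hVint] with x h1 h2
    rw [Function.comp_apply, ← heq ⟨h1, hPσ x h1 ▸ h2⟩]
    simp only [kernelOp]
    rw [← hPσ x h1]) (by
    intro f hf
    -- The strongly measurable representative makes this function of v measurable.
    refine ⟨fun v => kernelOp P (hf.1.mk f) (σ v),
      ((hf.1.stronglyMeasurable_mk.integral_kernel (κ := P)).measurable).comp hσm, ?_⟩
    filter_upwards [kernelOp_congr hrev.invariant hf.1.ae_eq_mk, hVmem] with x h1 h2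
    rw [h1]
    simp only [kernelOp, Function.comp_apply]
    rw [← hPσ x h2])
  refine ⟨hM, hrev.invariant, ?_⟩
  have hle := l2OpNormSub_le hrev.invariant C.coe_nonneg hnorm
  have hgap : ((m / (k + m) : ℝ) : EReal) = 1 - ((ENNReal.ofReal (C : ℝ) : ℝ≥0∞) : EReal) := by
    rw [EReal.coe_ennreal_ofReal, max_eq_left C.coe_nonneg, ← EReal.coe_one, ← EReal.coe_sub]
    congr 1
    change m / (k + m) = 1 - k / (k + m)
    field_simp
    ring
  rw [hgap, spectralGap]
  exact EReal.sub_le_sub le_rfl (by exact_mod_cast hle)
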